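/- Let $H$ be a complex Hilbert space (not necessarily separable or finite-dimensional), let $H\hat\otimes_2 H$ be its Hilbertian tensor square (the completion of $H\otimes_{\mathbb C}H$ for the inner product with $\langle x\otimes y,x'\otimes y'\rangle=\langle x,x'\rangle\langle y,y'\rangle$), and let $\mu\colon H\hat\otimes_2 H\to H$ be a bounded linear map. Let $\alpha\colon (H\hat\otimes_2 H)\hat\otimes_2 H\to H\hat\otimes_2(H\hat\otimes_2 H)$ be the unitary associator, $(x\otimes y)\otimes z\mapsto x\otimes(y\otimes z)$, let $\sigma\colon H\hat\otimes_2H\to H\hat\otimes_2H$ be the unitary flip, $x\otimes y\mapsto y\otimes x$, and let $^\dagger$ denote the Hilbert adjoint. Assume that $(H,\mu)$ is a (commutative) Hilbertian algebra, that is, $\mu\circ(\mu\hat\otimes_2 \mathrm{id})=\mu\circ(\mathrm{id}\hat\otimes_2\mu)\circ\alpha$ and $\mu\circ\sigma=\mu$. For $u\in H$ let $M_u\colon H\to H$ be the bounded operator $M_u(w)=\mu(u\otimes w)$. Then the following are equivalent: 1. $(H,\mu)$ is a Hilbertian $H^*$-algebra: for every $u\in H$ there is $v\in H$ with $M_u^\dagger=M_v$.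 2. $(H,\mu)$ is a Hilbertian Frobenius semigroup: $$(\mu\hat\otimes_2\mathrm{id})\circ\alpha^{-1}\circ(\mathrm{id}\hat\otimes_2\mu^\dagger)=\mu^\dagger\circ\mu=(\mathrm{id}\hat\otimes_2\mu)\circ\alpha\circ(\mu^\dagger\hat\otimes_2\mathrm{id}).$$ -/

import Mathlib

open scoped TensorProduct

noncomputable section

universe u v w

/-! ### The Hilbertian tensor product -/

/-- The Hilbertian tensor product of `H` and `K`: the completion of the algebraic tensor product
with respect to the inner product `⟪x ⊗ y, x' ⊗ y'⟫ = ⟪x, x'⟫ * ⟪y, y'⟫`. -/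
abbrev HilbertTensor (H : Type u) (K : Type v)
    [NormedAddCommGroup H] [InnerProductSpace ℂ H]
    [NormedAddCommGroup K] [InnerProductSpace ℂ K] : Type (max u v) :=
  UniformSpace.Completion (H ⊗[ℂ] K)

namespace HilbertTensor

section Basic

variable {H : Type u} {K : Type v} {L : Type w}
  [NormedAddCommGroup H] [InnerProductSpace ℂ H]
  [NormedAddCommGroup K] [InnerProductSpace ℂ K]
  [NormedAddCommGroup L] [InnerProductSpace ℂ L]

/-- The elementary tensor `x ⊗ y`. -/
def tmul (x : H) (y : K) : HilbertTensor H K :=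
  ((x ⊗ₜ[ℂ] y : H ⊗[ℂ] K) : UniformSpace.Completion (H ⊗[ℂ] K))

/-- The bounded linear map `y ↦ x ⊗ y`. -/
def tmulLeft (K : Type v) [NormedAddCommGroup K] [InnerProductSpace ℂ K] (x : H) :
    K →L[ℂ] HilbertTensor H K :=
  UniformSpace.Completion.toComplL ∘L TensorProduct.mkL ℂ H K x

@[simp] theorem tmulLeft_apply (x : H) (y : K) : tmulLeft K x y = tmul x y := rfl

theorem inner_tmul (x x' : H) (y y' : K) :
    inner ℂ (tmul x y) (tmul x' y') = inner ℂ x x' * inner ℂ y y' := by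
  simp [tmul]

/-- The symmetry constraint `x ⊗ y ↦ y ⊗ x`. -/
def comm (H : Type u) (K : Type v)
    [NormedAddCommGroup H] [InnerProductSpace ℂ H]
    [NormedAddCommGroup K] [InnerProductSpace ℂ K] :
    HilbertTensor H K →L[ℂ] HilbertTensor K H :=
  ((TensorProduct.commIsometry ℂ H K).toContinuousLinearEquiv :
    H ⊗[ℂ] K →L[ℂ] K ⊗[ℂ] H).completion

@[simp] theorem comm_tmul (x : H) (y : K) : comm H K (tmul x y) = tmul y x := by
  simp [comm, tmul]

/-- The canonical isometry of the algebraic triple tensor product into the Hilbertian one, with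
parentheses on the left. -/
def embLeft (H : Type u) (K : Type v) (L : Type w)
    [NormedAddCommGroup H] [InnerProductSpace ℂ H]
    [NormedAddCommGroup K] [InnerProductSpace ℂ K]
    [NormedAddCommGroup L] [InnerProductSpace ℂ L] :
    (H ⊗[ℂ] K) ⊗[ℂ] L →ₗᵢ[ℂ] HilbertTensor (HilbertTensor H K) L :=
  UniformSpace.Completion.toComplₗᵢ.comp
    (TensorProduct.mapIsometry UniformSpace.Completion.toComplₗᵢ LinearIsometry.id)

/-- The canonical isometry of the algebraic triple tensor product into the Hilbertian one, with
parentheses on the right. -/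
def embRight (H : Type u) (K : Type v) (L : Type w)
    [NormedAddCommGroup H] [InnerProductSpace ℂ H]
    [NormedAddCommGroup K] [InnerProductSpace ℂ K]
    [NormedAddCommGroup L] [InnerProductSpace ℂ L] :
    H ⊗[ℂ] (K ⊗[ℂ] L) →ₗᵢ[ℂ] HilbertTensor H (HilbertTensor K L) :=
  UniformSpace.Completion.toComplₗᵢ.comp
    (TensorProduct.mapIsometry LinearIsometry.id UniformSpace.Completion.toComplₗᵢ)

@[simp] theorem embLeft_tmul (x : H) (y : K) (z : L) :
    embLeft H K L ((x ⊗ₜ y) ⊗ₜ z) = tmul (tmul x y) z := rfl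

@[simp] theorem embRight_tmul (x : H) (y : K) (z : L) :
    embRight H K L (x ⊗ₜ (y ⊗ₜ z)) = tmul x (tmul y z) := rfl

theorem denseRange_embLeft : DenseRange (embLeft H K L) := by
  have h : DenseRange (TensorProduct.mapIsometry
      (UniformSpace.Completion.toComplₗᵢ : (H ⊗[ℂ] K) →ₗᵢ[ℂ] HilbertTensor H K)
      (LinearIsometry.id : L →ₗᵢ[ℂ] L)) := by
    intro t
    induction t with
    | zero => exact subset_closure ⟨0, map_zero _⟩
    | add a b ha hb =>
      rw [← LinearIsometry.coe_toLinearMap, ← LinearMap.coe_range,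
        ← Submodule.topologicalClosure_coe] at ha hb ⊢
      exact add_mem ha hb
    | tmul a z =>
      induction a using UniformSpace.Completion.induction_on with
      | hp =>
        exact isClosed_closure.preimage
          (TensorProduct.continuous_tmul.comp (continuous_id.prodMk continuous_const))
      | ih a => exact subset_closure ⟨a ⊗ₜ z, rfl⟩
  exact UniformSpace.Completion.denseRange_coe.comp h (UniformSpace.Completion.continuous_coe _)

theorem denseRange_embRight : DenseRange (embRight H K L) := by
  have h : DenseRange (TensorProduct.mapIsometry (LinearIsometry.id : H →ₗᵢ[ℂ] H)
      (UniformSpace.Completion.toComplₗᵢ : (K ⊗[ℂ] L) →ₗᵢ[ℂ] HilbertTensor K L)) := by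
    intro t
    induction t with
    | zero => exact subset_closure ⟨0, map_zero _⟩
    | add a b ha hb =>
      rw [← LinearIsometry.coe_toLinearMap, ← LinearMap.coe_range,
        ← Submodule.topologicalClosure_coe] at ha hb ⊢
      exact add_mem ha hb
    | tmul x b =>
      induction b using UniformSpace.Completion.induction_on with
      | hp =>
        exact isClosed_closure.preimage
          (TensorProduct.continuous_tmul.comp (continuous_const.prodMk continuous_id))
      | ih b => exact subset_closure ⟨x ⊗ₜ b, rfl⟩
  exact UniformSpace.Completion.denseRange_coe.comp h (UniformSpace.Completion.continuous_coe _)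

theorem norm_embRight_assoc (t : (H ⊗[ℂ] K) ⊗[ℂ] L) :
    ‖(embRight H K L).toLinearMap (TensorProduct.assoc ℂ H K L t)‖ =
      ‖(embLeft H K L).toLinearMap t‖ :=
  ((embRight H K L).norm_map _).trans
    ((TensorProduct.norm_assoc t).trans ((embLeft H K L).norm_map t).symm)

/-- The associativity constraint: the unitary map with `(x ⊗ y) ⊗ z ↦ x ⊗ (y ⊗ z)`. -/
def assoc (H : Type u) (K : Type v) (L : Type w)
    [NormedAddCommGroup H] [InnerProductSpace ℂ H]
    [NormedAddCommGroup K] [InnerProductSpace ℂ K]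
    [NormedAddCommGroup L] [InnerProductSpace ℂ L] :
    HilbertTensor (HilbertTensor H K) L ≃ₗᵢ[ℂ] HilbertTensor H (HilbertTensor K L) :=
  (TensorProduct.assoc ℂ H K L).extendOfIsometry
    (embLeft H K L).toLinearMap (embRight H K L).toLinearMap
    denseRange_embLeft denseRange_embRight norm_embRight_assoc

@[simp] theorem assoc_tmul (x : H) (y : K) (z : L) :
    assoc H K L (tmul (tmul x y) z) = tmul x (tmul y z) :=
  LinearEquiv.extendOfIsometry_eq _ (embLeft H K L).toLinearMap (embRight H K L).toLinearMap
    denseRange_embLeft denseRange_embRight norm_embRight_assoc ((x ⊗ₜ y) ⊗ₜ z)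

@[simp] theorem assoc_symm_tmul (x : H) (y : K) (z : L) :
    (assoc H K L).symm (tmul x (tmul y z)) = tmul (tmul x y) z := by
  rw [← assoc_tmul, LinearIsometryEquiv.symm_apply_apply]

end Basic

section Map

variable {H H' K K' : Type u}
  [NormedAddCommGroup H] [InnerProductSpace ℂ H]
  [NormedAddCommGroup H'] [InnerProductSpace ℂ H']
  [NormedAddCommGroup K] [InnerProductSpace ℂ K]
  [NormedAddCommGroup K'] [InnerProductSpace ℂ K']

/-- The Hilbertian tensor product of two bounded linear maps. -/
def map (f : H →L[ℂ] H') (g : K →L[ℂ] K') : HilbertTensor H K →L[ℂ] HilbertTensor H' K' :=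
  (TensorProduct.mapL f g).completion

@[simp] theorem map_tmul (f : H →L[ℂ] H') (g : K →L[ℂ] K') (x : H) (y : K) :
    map f g (tmul x y) = tmul (f x) (g y) := by
  simp [map, tmul]

end Map

end HilbertTensor

/-! ### Hilbertian algebras -/

section Algebras

variable {H : Type u} [NormedAddCommGroup H] [InnerProductSpace ℂ H]

/-- `(H, μ)` is a Hilbertian algebra: a commutative semigroup object in the symmetric monoidal
category of complex Hilbert spaces with the Hilbertian tensor product. -/
structure IsHilbertianAlgebra (μ : HilbertTensor H H →L[ℂ] H) : Prop where
  assoc : μ ∘L HilbertTensor.map μ (ContinuousLinearMap.id ℂ H) =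
    μ ∘L HilbertTensor.map (ContinuousLinearMap.id ℂ H) μ ∘L
      ((HilbertTensor.assoc H H H).toContinuousLinearEquiv :
        HilbertTensor (HilbertTensor H H) H →L[ℂ] HilbertTensor H (HilbertTensor H H))
  comm : μ ∘L HilbertTensor.comm H H = μ

/-- The multiplication operator `M_u : v ↦ u v = μ (u ⊗ v)`. -/
def mulOperator (μ : HilbertTensor H H →L[ℂ] H) (u : H) : H →L[ℂ] H :=
  μ ∘L HilbertTensor.tmulLeft H u

@[simp] theorem mulOperator_apply (μ : HilbertTensor H H →L[ℂ] H) (u v : H) :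
    mulOperator μ u v = μ (HilbertTensor.tmul u v) := rfl

variable [CompleteSpace H]

/-- `v` is an `H*`-adjoint of `u`: the Hilbert adjoint of `M_u` is `M_v`. -/
def IsHStarAdjoint (μ : HilbertTensor H H →L[ℂ] H) (u v : H) : Prop :=
  ContinuousLinearMap.adjoint (mulOperator μ u) = mulOperator μ v

/-- `(H, μ)` is a Hilbertian `H*`-algebra: a Hilbertian algebra each element of which has an
`H*`-adjoint. -/
structure IsHilbertianHStarAlgebra (μ : HilbertTensor H H →L[ℂ] H) : Prop
    extends IsHilbertianAlgebra μ where
  exists_adjoint : ∀ u : H, ∃ v : H, IsHStarAdjoint μ u v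

/-- The Frobenius condition on `μ`, with `δ` the Hilbert adjoint of `μ`:
`(μ ⊗ id) ∘ α⁻¹ ∘ (id ⊗ δ) = δ ∘ μ` and `(id ⊗ μ) ∘ α ∘ (δ ⊗ id) = δ ∘ μ`. -/
structure IsDaggerFrobenius (μ : HilbertTensor H H →L[ℂ] H) : Prop where
  top_cell :
    HilbertTensor.map μ (ContinuousLinearMap.id ℂ H) ∘L
      ((HilbertTensor.assoc H H H).symm.toContinuousLinearEquiv :
        HilbertTensor H (HilbertTensor H H) →L[ℂ] HilbertTensor (HilbertTensor H H) H) ∘L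
      HilbertTensor.map (ContinuousLinearMap.id ℂ H) (ContinuousLinearMap.adjoint μ) =
    ContinuousLinearMap.adjoint μ ∘L μ
  bottom_cell :
    HilbertTensor.map (ContinuousLinearMap.id ℂ H) μ ∘L
      ((HilbertTensor.assoc H H H).toContinuousLinearEquiv :
        HilbertTensor (HilbertTensor H H) H →L[ℂ] HilbertTensor H (HilbertTensor H H)) ∘L
      HilbertTensor.map (ContinuousLinearMap.adjoint μ) (ContinuousLinearMap.id ℂ H) =
    ContinuousLinearMap.adjoint μ ∘L μ

/-- `(H, μ)` is a Hilbertian Frobenius semigroup: a Hilbertian algebra satisfying the Frobenius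
condition. -/
structure IsHilbertianFrobeniusSemigroup (μ : HilbertTensor H H →L[ℂ] H) : Prop
    extends IsHilbertianAlgebra μ, IsDaggerFrobenius μ

end Algebras

end

/-! If `M_u† = M_v`, associativity gives `M_u†(xy) = (M_u† x)y`. The adjoint of this identity is the
Frobenius condition evaluated at an elementary tensor. Conversely, the Frobenius condition makes
every `M_y†` a module map (`adjoint_mulOperator_mul`), so `M_y† z` has `H*`-adjoint `M_z† y`. On
sums of such pairs the two components have equal norm (`norm_fst_eq_norm_snd`), so adjoints survive
limits and exist on the closed span of the `M_y† z`. Any `a` orthogonal to that span has `M_a = 0`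
(`mulOperator_eq_zero`), so the orthogonal decomposition of `u` yields an adjoint. -/

namespace HilbertTensor

/-! ### Elementary tensors and adjoints of tensor maps -/

section Ext

variable {H : Type u} {K : Type v} {E : Type w}
  [NormedAddCommGroup H] [InnerProductSpace ℂ H]
  [NormedAddCommGroup K] [InnerProductSpace ℂ K]
  [NormedAddCommGroup E] [NormedSpace ℂ E]

/-- Bounded linear maps on a Hilbertian tensor product are determined by elementary tensors. -/
theorem ext_tmul {f g : HilbertTensor H K →L[ℂ] E}
    (h : ∀ x y, f (tmul x y) = g (tmul x y)) : f = g := by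
  ext t
  induction t using UniformSpace.Completion.induction_on with
  | hp => exact isClosed_eq f.continuous g.continuous
  | ih t =>
    induction t with
    | zero => rw [UniformSpace.Completion.coe_zero, map_zero, map_zero]
    | add a b ha hb => simp only [UniformSpace.Completion.coe_add, map_add, ha, hb]
    | tmul x y => exact h x y

/-- The bounded linear map `x ↦ x ⊗ y`. -/
noncomputable def tmulRight (H : Type u) [NormedAddCommGroup H] [InnerProductSpace ℂ H] (y : K) :
    H →L[ℂ] HilbertTensor H K :=
  comm K H ∘L tmulLeft H y

@[simp] theorem tmulRight_apply (x : H) (y : K) : tmulRight H y x = tmul x y := by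
  simp [tmulRight]

end Ext

section Adjoint

variable {H H' K K' : Type u}
  [NormedAddCommGroup H] [InnerProductSpace ℂ H] [CompleteSpace H]
  [NormedAddCommGroup H'] [InnerProductSpace ℂ H'] [CompleteSpace H']
  [NormedAddCommGroup K] [InnerProductSpace ℂ K] [CompleteSpace K]
  [NormedAddCommGroup K'] [InnerProductSpace ℂ K'] [CompleteSpace K']

theorem adjoint_map (f : H →L[ℂ] H') (g : K →L[ℂ] K') :
    ContinuousLinearMap.adjoint (map f g) =
      map (ContinuousLinearMap.adjoint f) (ContinuousLinearMap.adjoint g) := by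
  refine ext_tmul fun x' y' => ?_
  refine ext_inner_left ℂ fun t => ?_
  have h : innerSL ℂ (tmul x' y') ∘L map f g =
      innerSL ℂ (map (ContinuousLinearMap.adjoint f) (ContinuousLinearMap.adjoint g)
        (tmul x' y')) := by
    refine ext_tmul fun x y => ?_
    simp [inner_tmul, ContinuousLinearMap.adjoint_inner_left]
  have ht := DFunLike.congr_fun h t
  simp only [ContinuousLinearMap.comp_apply, innerSL_apply_apply] at ht
  rw [ContinuousLinearMap.adjoint_inner_right, ← inner_conj_symm, ht, inner_conj_symm]

end Adjoint

end HilbertTensor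

/-! ### Multiplication operators -/

section Algebras

open HilbertTensor

variable {H : Type u} [NormedAddCommGroup H] [InnerProductSpace ℂ H]

/-- Reduces the top Frobenius cell at `u ⊗ w` to an identity about `M_u ⊗ id`. -/
theorem map_assoc_symm_tmul (μ : HilbertTensor H H →L[ℂ] H) (u : H) (t : HilbertTensor H H) :
    map μ (ContinuousLinearMap.id ℂ H) ((assoc H H H).symm (tmul u t)) =
      map (mulOperator μ u) (ContinuousLinearMap.id ℂ H) t := by
  have h : map μ (ContinuousLinearMap.id ℂ H) ∘L
      ((assoc H H H).symm.toContinuousLinearEquiv :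
        HilbertTensor H (HilbertTensor H H) →L[ℂ] HilbertTensor (HilbertTensor H H) H) ∘L
      tmulLeft (HilbertTensor H H) u = map (mulOperator μ u) (ContinuousLinearMap.id ℂ H) :=
    ext_tmul fun x y => by simp
  exact DFunLike.congr_fun h t

namespace IsHilbertianAlgebra

variable {μ : HilbertTensor H H →L[ℂ] H}

theorem mul_comm (hμ : IsHilbertianAlgebra μ) (x y : H) : μ (tmul x y) = μ (tmul y x) := by
  simpa using (DFunLike.congr_fun hμ.comm (tmul y x))

theorem mul_assoc (hμ : IsHilbertianAlgebra μ) (x y z : H) :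
    μ (tmul (μ (tmul x y)) z) = μ (tmul x (μ (tmul y z))) := by
  simpa using (DFunLike.congr_fun hμ.assoc (tmul (tmul x y) z))

/-- Multiplying by `w` on the right is `M_w` only thanks to commutativity. -/
theorem map_assoc_tmul (hμ : IsHilbertianAlgebra μ) (w : H) (t : HilbertTensor H H) :
    map (ContinuousLinearMap.id ℂ H) μ (HilbertTensor.assoc H H H (tmul t w)) =
      map (ContinuousLinearMap.id ℂ H) (mulOperator μ w) t := by
  have h : map (ContinuousLinearMap.id ℂ H) μ ∘L
      ((HilbertTensor.assoc H H H).toContinuousLinearEquiv :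
        HilbertTensor (HilbertTensor H H) H →L[ℂ] HilbertTensor H (HilbertTensor H H)) ∘L
      tmulRight (HilbertTensor H H) w = map (ContinuousLinearMap.id ℂ H) (mulOperator μ w) :=
    ext_tmul fun x y => by simp [hμ.mul_comm y w]
  simpa using DFunLike.congr_fun h t

end IsHilbertianAlgebra

theorem continuous_mulOperator_apply (μ : HilbertTensor H H →L[ℂ] H) (x : H) :
    Continuous fun u => mulOperator μ u x := by
  have : (fun u => mulOperator μ u x) = μ ∘L tmulRight H x := by
    ext u; simp
  rw [this]
  exact ContinuousLinearMap.continuous _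

theorem mulOperator_add (μ : HilbertTensor H H →L[ℂ] H) (u v : H) :
    mulOperator μ (u + v) = mulOperator μ u + mulOperator μ v := by
  ext x
  simpa using map_add (μ ∘L tmulRight H x) u v

theorem mulOperator_neg (μ : HilbertTensor H H →L[ℂ] H) (u : H) :
    mulOperator μ (-u) = -mulOperator μ u := by
  ext x
  simpa using map_neg (μ ∘L tmulRight H x) u

theorem mulOperator_zero (μ : HilbertTensor H H →L[ℂ] H) : mulOperator μ 0 = 0 := by
  ext x
  simpa using map_zero (μ ∘L tmulRight H x)

variable [CompleteSpace H] {μ : HilbertTensor H H →L[ℂ] H}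

/-- The Hilbert adjoint of the multiplication operator `M_u`. -/
noncomputable abbrev mulAdjoint (μ : HilbertTensor H H →L[ℂ] H) (u : H) : H →L[ℂ] H :=
  ContinuousLinearMap.adjoint (mulOperator μ u)

/-! ### From `H*`-adjoints to the Frobenius condition -/

theorem IsHilbertianHStarAlgebra.isDaggerFrobenius (h : IsHilbertianHStarAlgebra μ) :
    IsDaggerFrobenius μ := by
  have hμ := h.toIsHilbertianAlgebra
  constructor
  · refine ext_tmul fun u w => ?_
    obtain ⟨v, hv : mulAdjoint μ u = mulOperator μ v⟩ := h.exists_adjoint u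
    -- This is `(vx)y = v(xy)`; its adjoint reads `(M_u ⊗ id) μ† = μ† M_u`.
    have key : μ ∘L map (mulAdjoint μ u) (ContinuousLinearMap.id ℂ H) = mulAdjoint μ u ∘L μ :=
      ext_tmul fun x y => by
        simp only [ContinuousLinearMap.comp_apply, map_tmul, hv, mulOperator_apply,
          ContinuousLinearMap.id_apply, hμ.mul_assoc]
    have key' := congrArg ContinuousLinearMap.adjoint key
    simp only [ContinuousLinearMap.adjoint_comp, adjoint_map, ContinuousLinearMap.adjoint_adjoint,
      ContinuousLinearMap.adjoint_id] at key'
    simpa [map_assoc_symm_tmul] using DFunLike.congr_fun key' w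
  · refine ext_tmul fun w u => ?_
    obtain ⟨v, hv : mulAdjoint μ u = mulOperator μ v⟩ := h.exists_adjoint u
    have key : μ ∘L map (ContinuousLinearMap.id ℂ H) (mulAdjoint μ u) = mulAdjoint μ u ∘L μ :=
      ext_tmul fun x y => by
        simp only [ContinuousLinearMap.comp_apply, map_tmul, hv, mulOperator_apply,
          ContinuousLinearMap.id_apply]
        rw [← hμ.mul_assoc, hμ.mul_comm x v, hμ.mul_assoc]
    have key' := congrArg ContinuousLinearMap.adjoint key
    simp only [ContinuousLinearMap.adjoint_comp, adjoint_map, ContinuousLinearMap.adjoint_adjoint,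
      ContinuousLinearMap.adjoint_id] at key'
    simpa [hμ.map_assoc_tmul, hμ.mul_comm w u] using DFunLike.congr_fun key' w

/-! ### From the Frobenius condition to adjoint pairs -/

/-- Adjoints of multiplication operators are module maps in a Frobenius semigroup. -/
theorem IsDaggerFrobenius.adjoint_mulOperator_mul (h : IsDaggerFrobenius μ) (u x y : H) :
    mulAdjoint μ u (μ (tmul x y)) = μ (tmul (mulAdjoint μ u x) y) := by
  have key : map (mulOperator μ u) (ContinuousLinearMap.id ℂ H) ∘L ContinuousLinearMap.adjoint μ =
      ContinuousLinearMap.adjoint μ ∘L mulOperator μ u := by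
    ext w
    simpa [map_assoc_symm_tmul] using DFunLike.congr_fun h.top_cell (tmul u w)
  have key' := congrArg ContinuousLinearMap.adjoint key
  simp only [ContinuousLinearMap.adjoint_comp, adjoint_map, ContinuousLinearMap.adjoint_adjoint,
    ContinuousLinearMap.adjoint_id] at key'
  simpa using (DFunLike.congr_fun key' (tmul x y)).symm

theorem isHStarAdjoint_iff_inner {u v : H} :
    IsHStarAdjoint μ u v ↔
      ∀ x y, inner ℂ x (mulOperator μ u y) = inner ℂ (mulOperator μ v x) y := by
  rw [IsHStarAdjoint, eq_comm, ContinuousLinearMap.eq_adjoint_iff]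
  exact forall₂_congr fun x y => eq_comm

/-- Lets the relation pass to limits of pairs, once both components converge. -/
theorem isClosed_isHStarAdjoint (μ : HilbertTensor H H →L[ℂ] H) :
    IsClosed {p : H × H | IsHStarAdjoint μ p.1 p.2} := by
  simp only [isHStarAdjoint_iff_inner, Set.ofPred_forall]
  refine isClosed_iInter fun x => isClosed_iInter fun y => isClosed_eq ?_ ?_
  · exact continuous_const.inner ((continuous_mulOperator_apply μ y).comp continuous_fst)
  · exact ((continuous_mulOperator_apply μ x).comp continuous_snd).inner continuous_const

theorem IsHStarAdjoint.add {u v u' v' : H} (h : IsHStarAdjoint μ u v)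
    (h' : IsHStarAdjoint μ u' v') : IsHStarAdjoint μ (u + u') (v + v') := by
  rw [IsHStarAdjoint, mulOperator_add, mulOperator_add, map_add, h, h']

theorem IsHStarAdjoint.neg {u v : H} (h : IsHStarAdjoint μ u v) :
    IsHStarAdjoint μ (-u) (-v) := by
  rw [IsHStarAdjoint, mulOperator_neg, mulOperator_neg, map_neg, h]

theorem isHStarAdjoint_zero (μ : HilbertTensor H H →L[ℂ] H) : IsHStarAdjoint μ 0 0 := by
  rw [IsHStarAdjoint, mulOperator_zero, map_zero]

/-- The additive group generated by the pairs `(M_y† z, M_z† y)`. -/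
def adjointPairs (μ : HilbertTensor H H →L[ℂ] H) : AddSubgroup (H × H) :=
  AddSubgroup.closure (Set.range fun q : H × H => (mulAdjoint μ q.1 q.2, mulAdjoint μ q.2 q.1))

theorem pair_mem_adjointPairs (μ : HilbertTensor H H →L[ℂ] H) (y z : H) :
    (mulAdjoint μ y z, mulAdjoint μ z y) ∈ adjointPairs μ :=
  AddSubgroup.subset_closure ⟨(y, z), rfl⟩

namespace IsHilbertianFrobeniusSemigroup

/-- The module property gives `M_{M_y† z} = M_y† M_z`, whose adjoint `M_z† M_y` has the same form
with `y` and `z` swapped. -/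
theorem isHStarAdjoint_pair (h : IsHilbertianFrobeniusSemigroup μ) (y z : H) :
    IsHStarAdjoint μ (mulAdjoint μ y z) (mulAdjoint μ z y) := by
  have e (y z : H) : mulOperator μ (mulAdjoint μ y z) = mulAdjoint μ y ∘L mulOperator μ z := by
    ext x
    exact (h.adjoint_mulOperator_mul y z x).symm
  rw [IsHStarAdjoint, e, e, ContinuousLinearMap.adjoint_comp, ContinuousLinearMap.adjoint_adjoint]

theorem isHStarAdjoint_of_mem (h : IsHilbertianFrobeniusSemigroup μ) {p : H × H}
    (hp : p ∈ adjointPairs μ) : IsHStarAdjoint μ p.1 p.2 := by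
  induction hp using AddSubgroup.closure_induction with
  | mem p hp =>
    obtain ⟨⟨y, z⟩, rfl⟩ := hp
    exact h.isHStarAdjoint_pair y z
  | zero => exact isHStarAdjoint_zero μ
  | add p q _ _ hp hq => exact hp.add hq
  | neg p _ hp => exact hp.neg

end IsHilbertianFrobeniusSemigroup

/-- On a generator, `⟪u, M_y† z⟫ = ⟪uy, z⟫ = ⟪y, vz⟫ = ⟪M_z† y, v⟫` by commutativity; both sides are
additive in `p`. -/
theorem IsHilbertianAlgebra.inner_eq_of_mem_adjointPairs (hμ : IsHilbertianAlgebra μ) {u v : H}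
    (huv : IsHStarAdjoint μ u v) {p : H × H} (hp : p ∈ adjointPairs μ) :
    inner ℂ u p.1 = inner ℂ p.2 v := by
  induction hp using AddSubgroup.closure_induction with
  | mem p hp =>
    obtain ⟨⟨y, z⟩, rfl⟩ := hp
    have h := isHStarAdjoint_iff_inner.1 huv z y
    simp only [mulOperator_apply] at h
    simp only [ContinuousLinearMap.adjoint_inner_right, ContinuousLinearMap.adjoint_inner_left,
      mulOperator_apply]
    rw [hμ.mul_comm y u, hμ.mul_comm z v, ← inner_conj_symm, h, inner_conj_symm]
  | zero => simp
  | add p q _ _ hp hq => simp only [Prod.fst_add, Prod.snd_add, inner_add_left, inner_add_right, hp, hq]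
  | neg p _ hp => simp [hp]

namespace IsHilbertianFrobeniusSemigroup

theorem norm_fst_eq_norm_snd (h : IsHilbertianFrobeniusSemigroup μ) {p : H × H}
    (hp : p ∈ adjointPairs μ) : ‖p.1‖ = ‖p.2‖ := by
  -- The pair `p` is itself an adjoint pair, so it can be tested against itself.
  have e := h.inner_eq_of_mem_adjointPairs (h.isHStarAdjoint_of_mem hp) hp
  rw [inner_self_eq_norm_sq_to_K, inner_self_eq_norm_sq_to_K] at e
  exact (pow_left_inj₀ (norm_nonneg _) (norm_nonneg _) two_ne_zero).1 (by exact_mod_cast e)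

/-- Equal norms make the first projection isometric on the closed group of pairs, which is complete,
so its image is closed. -/
theorem isClosed_image_fst (h : IsHilbertianFrobeniusSemigroup μ) :
    IsClosed (Prod.fst '' ((adjointPairs μ).topologicalClosure : Set (H × H))) := by
  have hn : ∀ p ∈ (adjointPairs μ).topologicalClosure, ‖p.1‖ = ‖p.2‖ := fun p hp =>
    closure_minimal (fun q hq => h.norm_fst_eq_norm_snd hq)
      (isClosed_eq continuous_fst.norm continuous_snd.norm) hp
  have hc : IsClosed ((adjointPairs μ).topologicalClosure : Set (H × H)) :=
    AddSubgroup.isClosed_topologicalClosure _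
  have : CompleteSpace (adjointPairs μ).topologicalClosure := hc.completeSpace_coe
  have hanti : AntilipschitzWith 1 fun p : (adjointPairs μ).topologicalClosure => p.1.1 := by
    refine AntilipschitzWith.of_le_mul_dist fun p q => ?_
    have e := hn _ (sub_mem p.2 q.2)
    rw [NNReal.coe_one, one_mul, Subtype.dist_eq, dist_eq_norm, dist_eq_norm, Prod.norm_def, ← e,
      max_self, Prod.fst_sub]
  have hr := hanti.isClosed_range (uniformContinuous_fst.comp uniformContinuous_subtype_val)
  rwa [Set.image_eq_range]

end IsHilbertianFrobeniusSemigroup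

/-! ### The closed span and its orthogonal complement -/

/-- Adjoints are conjugate-linear in `u`, so the pairs form no complex subspace, yet their first
components do. -/
theorem smul_mem_adjointPairs {p : H × H} (hp : p ∈ adjointPairs μ) (c : ℂ) :
    (c • p.1, (starRingEnd ℂ c) • p.2) ∈ adjointPairs μ := by
  induction hp using AddSubgroup.closure_induction with
  | mem p hp =>
    obtain ⟨⟨y, z⟩, rfl⟩ := hp
    have e : mulAdjoint μ (c • z) y = (starRingEnd ℂ c) • mulAdjoint μ z y := by
      have : mulOperator μ (c • z) = c • mulOperator μ z := by
        ext x
        have := (μ ∘L tmulRight H x).map_smul c z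
        simpa only [ContinuousLinearMap.comp_apply, tmulRight_apply, smul_apply,
          mulOperator_apply] using this
      rw [mulAdjoint, this, map_smulₛₗ, smul_apply]
    simpa only [map_smul, e] using pair_mem_adjointPairs μ y (c • z)
  | zero => simpa only [Prod.fst_zero, Prod.snd_zero, smul_zero, Prod.mk_zero_zero] using
      zero_mem (adjointPairs μ)
  | add p q _ _ hp hq => simpa [smul_add] using add_mem hp hq
  | neg p _ hp => simpa using neg_mem hp

/-- The linear span of the elements `M_y† z`. -/
def adjointSpan (μ : HilbertTensor H H →L[ℂ] H) : Submodule ℂ H :=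
  Submodule.span ℂ (Set.range fun q : H × H => mulAdjoint μ q.1 q.2)

theorem adjointSpan_subset (μ : HilbertTensor H H →L[ℂ] H) :
    (adjointSpan μ : Set H) ⊆ Prod.fst '' (adjointPairs μ : Set (H × H)) := by
  intro u hu
  induction hu using Submodule.span_induction with
  | mem u hu =>
    obtain ⟨⟨y, z⟩, rfl⟩ := hu
    exact ⟨_, pair_mem_adjointPairs μ y z, rfl⟩
  | zero => exact ⟨0, zero_mem _, rfl⟩
  | add u u' _ _ hu hu' =>
    obtain ⟨p, hp, rfl⟩ := hu
    obtain ⟨q, hq, rfl⟩ := hu'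
    exact ⟨p + q, add_mem hp hq, rfl⟩
  | smul c u _ hu =>
    obtain ⟨p, hp, rfl⟩ := hu
    exact ⟨_, smul_mem_adjointPairs hp c, rfl⟩

/-- Orthogonality to `M_y† z` says `⟪z, ya⟫ = 0`, for all `y` and `z`. -/
theorem IsHilbertianAlgebra.mulOperator_eq_zero (hμ : IsHilbertianAlgebra μ) {a : H}
    (ha : a ∈ (adjointSpan μ)ᗮ) : mulOperator μ a = 0 := by
  ext y
  refine ext_inner_left ℂ fun z => ?_
  have := (Submodule.mem_orthogonal _ _).1 ha _ (Submodule.subset_span ⟨(y, z), rfl⟩)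
  simp only [ContinuousLinearMap.adjoint_inner_left, mulOperator_apply] at this
  rw [mulOperator_apply, hμ.mul_comm, this, zero_apply, inner_zero_right]

theorem IsHilbertianFrobeniusSemigroup.exists_isHStarAdjoint
    (h : IsHilbertianFrobeniusSemigroup μ) (u : H) : ∃ v, IsHStarAdjoint μ u v := by
  obtain ⟨b, hb, a, ha, rfl⟩ :=
    (adjointSpan μ).topologicalClosure.exists_add_mem_mem_orthogonal u
  rw [Submodule.orthogonal_closure] at ha
  have hb' : b ∈ Prod.fst '' ((adjointPairs μ).topologicalClosure : Set (H × H)) :=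
    closure_minimal ((adjointSpan_subset μ).trans
      (Set.image_mono (AddSubgroup.le_topologicalClosure _))) h.isClosed_image_fst hb
  obtain ⟨p, hp, rfl⟩ := hb'
  have hp' : IsHStarAdjoint μ p.1 p.2 :=
    closure_minimal (fun q hq => h.isHStarAdjoint_of_mem hq) (isClosed_isHStarAdjoint μ) hp
  -- The orthogonal part `a` contributes nothing to `M_u`, so an adjoint of the component in the
  -- closed span suffices.
  refine ⟨p.2, ?_⟩
  rw [IsHStarAdjoint, mulOperator_add, h.mulOperator_eq_zero ha, add_zero, hp']

end Algebras

theorem mainTheorem8 {H : Type*} [NormedAddCommGroup H] [InnerProductSpace ℂ H] [CompleteSpace H]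
    (μ : HilbertTensor H H →L[ℂ] H) (hμ : IsHilbertianAlgebra μ) :
    IsHilbertianHStarAlgebra μ ↔ IsHilbertianFrobeniusSemigroup μ :=
  ⟨fun h => { toIsHilbertianAlgebra := hμ, toIsDaggerFrobenius := h.isDaggerFrobenius },
    fun h => { toIsHilbertianAlgebra := hμ, exists_adjoint := h.exists_isHStarAdjoint }⟩
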